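/- Twinning on $n$ bins starts with all loads $x_i^0=0$. In each round $t=0,1,2,\ldots$ it samples, independently of the past, one bin $i\in\{1,\ldots,n\}$ uniformly at random and, with $W^t:=\sum_{j} x_j^t$, sets $x_i^{t+1}=x_i^t+2$ if $x_i^t<W^t/n$ and $x_i^{t+1}=x_i^t+1$ if $x_i^t\ge W^t/n$; the other loads do not change. Let $\eta^m:=W^m/S^m$ be its sample efficiency, where $W^m$ is the number of balls allocated and $S^m$ the number of bin samples taken in the first $m$ rounds (so $S^m=m$). There exists a constant $\rho>0$ (not depending on $n$ or $m$) such that for all integers $n\ge 2$ and all integers $m\ge \rho^{-1}\cdot n\log n$, the Twinning process satisfies \[ \mathbf{E}[\eta^m]\ge 1+\rho \qquad\text{and}\qquad \mathbf{Pr}[\eta^m\ge 1+\rho]\ge 1-n^{-1/4}. \] -/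

import Mathlib

open MeasureTheory ProbabilityTheory

noncomputable section

/-- The total number of balls `W = ∑ i, x i` of a load vector `x` of `n` bins. -/
def totalBalls {n : ℕ} (x : Fin n → ℕ) : ℕ := ∑ i, x i

/-- One round of Twinning from the load vector `x` when the sampled bin is `i`: the bin gets two
balls if its load is strictly below the mean load `W / n`, and one ball otherwise. -/
def twinningStep {n : ℕ} (x : Fin n → ℕ) (i : Fin n) : Fin n → ℕ :=
  Function.update x i (if (x i : ℝ) < (totalBalls x : ℝ) / (n : ℝ) then x i + 2 else x i + 1)

/-- The load vector `x ^ t` of Twinning after `t` rounds, started from the empty load vector,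
when `b t` is the bin sampled in round `t` (rounds are numbered from `0`). -/
def twinningLoad {n : ℕ} (b : ℕ → Fin n) : ℕ → Fin n → ℕ
  | 0 => fun _ => 0
  | t + 1 => twinningStep (twinningLoad b t) (b t)

/-- The number `S ^ t` of bin samples taken by Twinning in the first `t` rounds: every round takes
exactly one sample. -/
def twinningSamples : ℕ → ℕ
  | 0 => 0
  | t + 1 => twinningSamples t + 1

/-- The sample efficiency `η ^ m = W ^ m / S ^ m` of Twinning: balls allocated per bin sample in
the first `m` rounds. -/
def twinningEfficiency {n : ℕ} (b : ℕ → Fin n) (m : ℕ) : ℝ :=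
  (totalBalls (twinningLoad b m) : ℝ) / (twinningSamples m : ℝ)

/-- The random bins `U 0, U 1, …` are independent and each is uniform on the `n` bins. -/
structure IsUniformBinSampling {Ω : Type*} [MeasurableSpace Ω] (μ : Measure Ω) {n : ℕ}
    (U : ℕ → Ω → Fin n) : Prop where
  measurable : ∀ t, Measurable (U t)
  indep : iIndepFun U μ
  uniform : ∀ t i, μ.real {ω | U t ω = i} = 1 / (n : ℝ)

end

namespace Twinning

open Finset

/-! ### Potentials and their one-round changes at a fixed load vector. -/

section Deterministic

/-! `W - t` counts the rounds that sampled an underloaded bin, so it must be shown to grow linearly.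
If such rounds were rare, the mean would keep rising past bins of moderate excess, raising
`profileSum`, while samples of far overloaded bins would be offset on average by the decrease of
`quadratic`. This cannot last, since `profileSum` is at most `weight / 2 * quadratic` plus a
multiple of `n` (`le_deficit`). `deficit` combines these effects into a supermartingale
(`local_drift`, `sum_deficit_twinningStep_le`).

Taking expectations bounds the mean efficiency. For the tail, low efficiency makes `deficit` at
least of order `weight * m`, while its positive part has second moment O(m + m²/n), because its
increments are controlled by `quadratic`, whose mean grows at most linearly. Chebyshev then gives
failure probability at most 1/(2n) once m is a large multiple of n. -/

/-- The load of bin `i` above the mean load. -/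
noncomputable def excess {n : ℕ} (x : Fin n → ℕ) (i : Fin n) : ℝ :=
  (x i : ℝ) - (totalBalls x : ℝ) / (n : ℝ)

/-- The number of balls that bin `i` gets when it is sampled at the load vector `x`. -/
noncomputable def increment {n : ℕ} (x : Fin n → ℕ) (i : Fin n) : ℝ :=
  if excess x i < 0 then 2 else 1

/-- The quadratic potential. -/
noncomputable def quadratic {n : ℕ} (x : Fin n → ℕ) : ℝ := ∑ i, excess x i ^ 2

/-- The convex function equal to `exp (-z)` for `0 ≤ z` and to its tangent `1 - z` for `z < 0`. -/
noncomputable def profile (z : ℝ) : ℝ := if 0 ≤ z then Real.exp (-z) else 1 - z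

/-- The negative of the derivative of `profile`. -/
noncomputable def profileSlope (z : ℝ) : ℝ := Real.exp (-max z 0)

/-- The sum of `profile` over the excesses of all bins. -/
noncomputable def profileSum {n : ℕ} (x : Fin n → ℕ) : ℝ := ∑ i, profile (excess x i)

/-- The weight of the quadratic potential, up to a factor `2`. -/
noncomputable def weight : ℝ := Real.exp (-17) / 16

/-- A potential which is a supermartingale along Twinning and whose value at time `t` is small only
if many rounds sampled an underloaded bin. -/
noncomputable def deficit {n : ℕ} (t : ℕ) (x : Fin n → ℕ) : ℝ :=
  (n : ℝ) - profileSum x + weight / 2 * quadratic x - 3 * ((totalBalls x : ℝ) - t)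
    + 16 * weight * t

lemma weight_pos : 0 < weight := by unfold weight; positivity

lemma weight_le : weight ≤ 1 / 288 := by
  have h : (18 : ℝ) ≤ Real.exp 17 := by linarith [Real.add_one_le_exp (17 : ℝ)]
  have h2 : Real.exp (-17) ≤ 1 / 18 := by
    rw [Real.exp_neg, ← one_div]
    exact one_div_le_one_div_of_le (by norm_num) h
  unfold weight; linarith

lemma profileSlope_nonneg (z : ℝ) : 0 ≤ profileSlope z := (Real.exp_pos _).le

lemma profileSlope_le_one (z : ℝ) : profileSlope z ≤ 1 :=
  Real.exp_le_one_iff.2 (by simp)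

/-- Convexity: the graph lies above each of its tangents. -/
lemma profile_tangent (a b : ℝ) : profile b + profileSlope b * (b - a) ≤ profile a := by
  unfold profile profileSlope
  have key : Real.exp (-b) * (1 + (b - a)) ≤ Real.exp (-a) := by
    have h : Real.exp (-a) = Real.exp (-b) * Real.exp (b - a) := by
      rw [← Real.exp_add]; ring_nf
    rw [h]
    exact mul_le_mul_of_nonneg_left (by linarith [Real.add_one_le_exp (b - a)])
      (Real.exp_pos _).le
  by_cases hb : 0 ≤ b
  · rw [if_pos hb, max_eq_left hb]
    by_cases ha : 0 ≤ a
    · rw [if_pos ha]; linarith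
    · rw [if_neg ha]
      have h1 : Real.exp (-b) ≤ 1 := Real.exp_le_one_iff.2 (by linarith)
      have h2 : Real.exp (-b) * (1 + b) ≤ 1 := by
        have h3 : Real.exp (-b) * Real.exp b = 1 := by rw [← Real.exp_add]; simp
        rw [← h3]
        exact mul_le_mul_of_nonneg_left (by linarith [Real.add_one_le_exp b])
          (Real.exp_pos _).le
      nlinarith
  · rw [if_neg hb, max_eq_right (by linarith)]
    simp only [neg_zero, Real.exp_zero, one_mul]
    by_cases ha : 0 ≤ a
    · rw [if_pos ha]; linarith [Real.add_one_le_exp (-a)]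
    · rw [if_neg ha]; linarith

lemma abs_profile_sub_le (a b : ℝ) : |profile a - profile b| ≤ |a - b| := by
  have h (a b : ℝ) : profile b - profile a ≤ |a - b| := by
    have h1 := profile_tangent a b
    have h2 : profileSlope b * (a - b) ≤ |a - b| := calc
      profileSlope b * (a - b) ≤ profileSlope b * |a - b| :=
        mul_le_mul_of_nonneg_left (le_abs_self _) (profileSlope_nonneg b)
      _ ≤ 1 * |a - b| := mul_le_mul_of_nonneg_right (profileSlope_le_one b) (abs_nonneg _)
      _ = |a - b| := one_mul _
    linarith
  exact abs_sub_le_iff.2 ⟨abs_sub_comm a b ▸ h b a, h a b⟩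

lemma profile_zero : profile 0 = 1 := by simp [profile]

lemma profile_le (z : ℝ) : profile z ≤ 1 + |z| := by
  have h := (abs_le.1 (abs_profile_sub_le z 0)).2
  rw [profile_zero, sub_zero] at h
  linarith

variable {n : ℕ}

lemma increment_pos (x : Fin n → ℕ) (j : Fin n) : 1 ≤ increment x j := by
  unfold increment; split_ifs <;> norm_num

lemma increment_le (x : Fin n → ℕ) (j : Fin n) : increment x j ≤ 2 := by
  unfold increment; split_ifs <;> norm_num

lemma cast_twinningStep (x : Fin n → ℕ) (i j : Fin n) :
    (twinningStep x j i : ℝ) = x i + if i = j then increment x j else 0 := by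
  unfold twinningStep increment excess
  by_cases h : i = j
  · subst h
    simp only [Function.update_self, sub_neg, if_true]
    split_ifs <;> push_cast <;> ring
  · simp [h]

lemma cast_totalBalls (x : Fin n → ℕ) : (totalBalls x : ℝ) = ∑ i, (x i : ℝ) := by
  simp [totalBalls]

lemma totalBalls_twinningStep (x : Fin n → ℕ) (j : Fin n) :
    (totalBalls (twinningStep x j) : ℝ) = totalBalls x + increment x j := by
  simp [cast_totalBalls, cast_twinningStep, sum_add_distrib]

lemma excess_twinningStep (x : Fin n → ℕ) (i j : Fin n) :
    excess (twinningStep x j) i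
      = excess x i - increment x j / n + if i = j then increment x j else 0 := by
  rw [excess, cast_twinningStep, totalBalls_twinningStep, excess]
  ring

lemma sum_excess [NeZero n] (x : Fin n → ℕ) : ∑ i, excess x i = 0 := by
  have hn : (n : ℝ) ≠ 0 := Nat.cast_ne_zero.2 (NeZero.ne n)
  simp only [excess, sum_sub_distrib, sum_const, card_univ, Fintype.card_fin, nsmul_eq_mul,
    ← cast_totalBalls]
  field_simp
  ring

lemma quadratic_twinningStep [NeZero n] (x : Fin n → ℕ) (j : Fin n) :
    quadratic (twinningStep x j) = quadratic x + 2 * (increment x j * excess x j)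
      + increment x j ^ 2 * (1 - 1 / n) := by
  have hn : (n : ℝ) ≠ 0 := Nat.cast_ne_zero.2 (NeZero.ne n)
  have h (i : Fin n) : excess (twinningStep x j) i ^ 2
      = excess x i ^ 2 - 2 * (increment x j / n) * excess x i + (increment x j / n) ^ 2
        + if i = j then 2 * (increment x j * (excess x j - increment x j / n))
          + increment x j ^ 2 else 0 := by
    rw [excess_twinningStep]
    split_ifs with hij
    · subst hij; ring
    · ring
  simp only [quadratic, h, sum_add_distrib, sum_sub_distrib, ← mul_sum, sum_excess, sum_const,
    card_univ, Fintype.card_fin, nsmul_eq_mul, sum_ite_eq', mem_univ, if_true]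
  field_simp
  ring

lemma one_sub_inv_mem (hn : 2 ≤ n) : (1 : ℝ) / 2 ≤ 1 - 1 / n ∧ (1 : ℝ) - 1 / n ≤ 1 := by
  have h2 : (2 : ℝ) ≤ n := by exact_mod_cast hn
  have h3 : (1 : ℝ) / n ≤ 1 / 2 := one_div_le_one_div_of_le (by norm_num) h2
  have h4 : (0 : ℝ) ≤ 1 / n := by positivity
  constructor <;> linarith

lemma sq_increment_mul_mem (hn : 2 ≤ n) (x : Fin n → ℕ) (j : Fin n) :
    0 ≤ increment x j ^ 2 * (1 - 1 / n) ∧ increment x j ^ 2 * (1 - 1 / n) ≤ 4 := by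
  obtain ⟨h1, h2⟩ := one_sub_inv_mem hn
  have h3 := increment_pos x j
  have h4 := increment_le x j
  have h5 : increment x j ^ 2 ≤ 4 := by nlinarith
  constructor
  · exact mul_nonneg (sq_nonneg _) (by linarith)
  · nlinarith [sq_nonneg (increment x j)]

lemma increment_mul_excess_le (x : Fin n → ℕ) (j : Fin n) :
    increment x j * excess x j ≤ excess x j := by
  unfold increment; split_ifs with h <;> linarith

lemma sum_quadratic_twinningStep_le (hn : 2 ≤ n) (x : Fin n → ℕ) :
    ∑ j, quadratic (twinningStep x j) ≤ n * (quadratic x + 4) := by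
  have : NeZero n := ⟨by omega⟩
  have h (j : Fin n) : quadratic (twinningStep x j) ≤ 2 * excess x j + (quadratic x + 4) := by
    rw [quadratic_twinningStep]
    linarith [increment_mul_excess_le x j, (sq_increment_mul_mem hn x j).2]
  refine (sum_le_sum fun j _ => h j).trans_eq ?_
  simp [sum_add_distrib, ← mul_sum, sum_excess, mul_add]

lemma abs_profileSum_twinningStep_sub_le [NeZero n] (x : Fin n → ℕ) (j : Fin n) :
    |profileSum (twinningStep x j) - profileSum x| ≤ 4 := by
  have hn : (n : ℝ) ≠ 0 := Nat.cast_ne_zero.2 (NeZero.ne n)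
  have hw := increment_pos x j
  have hw2 := increment_le x j
  have hw0 : 0 ≤ increment x j / n := by positivity
  have h (i : Fin n) : |profile (excess (twinningStep x j) i) - profile (excess x i)|
      ≤ increment x j / n + if i = j then increment x j else 0 := by
    refine (abs_profile_sub_le _ _).trans ?_
    rw [excess_twinningStep, abs_le]
    split_ifs <;> constructor <;> linarith
  rw [profileSum, profileSum, ← sum_sub_distrib]
  refine (abs_sum_le_sum_abs _ _).trans ((sum_le_sum fun i _ => h i).trans ?_)
  simp only [sum_add_distrib, sum_const, card_univ, Fintype.card_fin, nsmul_eq_mul, sum_ite_eq',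
    mem_univ, if_true]
  rw [mul_div_cancel₀ _ hn]
  linarith

/-- Each unsampled bin drops by at least `1 / n` relative to the mean, and its tangent bounds the
gain. The sampled bin is exact, so its share of the full slope sum is subtracted again. -/
lemma le_profileSum_twinningStep [NeZero n] (x : Fin n → ℕ) (j : Fin n) :
    profileSum x + (∑ i, profileSlope (excess x i)) / n
      + (profile (excess x j + increment x j * (1 - 1 / n)) - profile (excess x j)
        - profileSlope (excess x j) / n) ≤ profileSum (twinningStep x j) := by
  have hw := increment_pos x j
  have h (i : Fin n) : profile (excess x i) + profileSlope (excess x i) / n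
      + (if i = j then profile (excess x j + increment x j * (1 - 1 / n)) - profile (excess x j)
        - profileSlope (excess x j) / n else 0) ≤ profile (excess (twinningStep x j) i) := by
    rw [excess_twinningStep]
    split_ifs with hij
    · subst hij
      refine le_of_eq ?_
      rw [show excess x i + increment x i * (1 - 1 / n)
        = excess x i - increment x i / n + increment x i by ring]
      ring
    · have h1 := profile_tangent (excess x i - increment x j / n + 0) (excess x i)
      have h2 : profileSlope (excess x i) / n
          ≤ profileSlope (excess x i) * (increment x j / n) := by
        rw [mul_div_assoc', div_eq_mul_inv, div_eq_mul_inv]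
        refine mul_le_mul_of_nonneg_right ?_ (by positivity)
        nlinarith [profileSlope_nonneg (excess x i)]
      have h3 : excess x i - (excess x i - increment x j / n + 0) = increment x j / n := by ring
      rw [h3] at h1
      linarith
  have hs := sum_le_sum fun i (_ : i ∈ univ) => h i
  simp only [sum_add_distrib, ← sum_div, sum_ite_eq', mem_univ, if_true] at hs
  exact hs

/-- This fixes `weight`: the tangent of `exp (-y)` at 17 vanishes at 18, and 18 = 16 + 2 collects
the constant terms of the overloaded case in `local_drift`. -/
lemma exp_tangent_at_seventeen (y : ℝ) : 16 * weight * (18 - y) ≤ Real.exp (-y) := by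
  have h : Real.exp (-y) = Real.exp (-17) * Real.exp (17 - y) := by
    rw [← Real.exp_add]; ring_nf
  have h1 := Real.add_one_le_exp (17 - y)
  rw [h, weight]
  nlinarith [Real.exp_pos (-17)]

/-- The contribution of bin `j` to the expected change of `deficit`. -/
lemma local_drift (hn : 2 ≤ n) (x : Fin n → ℕ) (j : Fin n) :
    16 * weight + weight * (increment x j * excess x j + 2) - 3 * (increment x j - 1)
      - 2 * weight * excess x j
      ≤ profileSlope (excess x j)
        + (profile (excess x j + increment x j * (1 - 1 / n)) - profile (excess x j)
          - profileSlope (excess x j) / n) := by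
  obtain ⟨hu1, hu2⟩ := one_sub_inv_mem hn
  set h : ℝ := 1 / n
  set y := excess x j
  have hw0 := weight_pos
  have hw1 := weight_le
  rw [show profileSlope y / n = profileSlope y * h by simp only [h]; ring]
  by_cases hy : y < 0
  · have hi : increment x j = 2 := if_pos hy
    have hs : profileSlope y = 1 := by simp [profileSlope, max_eq_right hy.le]
    have hp := (abs_le.1 (abs_profile_sub_le (y + 2 * (1 - h)) y)).1
    rw [add_sub_cancel_left, abs_of_nonneg (by linarith)] at hp
    rw [hi, hs]
    linarith
  · have hy' : 0 ≤ y := not_lt.1 hy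
    have hi : increment x j = 1 := if_neg hy
    have hs : profileSlope y = Real.exp (-y) := by simp [profileSlope, max_eq_left hy']
    have hp : profile y = Real.exp (-y) := if_pos hy'
    have hp2 : profile (y + 1 * (1 - h)) = Real.exp (-y) * Real.exp (-(1 - h)) := by
      rw [profile, if_pos (by linarith), ← Real.exp_add]; ring_nf
    -- The direct bound `1 - u ≤ exp (-u)` would only give 0 in `hk`; halving the exponent first
    -- leaves 1/16, with equality at n = 2 in the resulting polynomial bound.
    have he : (1 - (1 - h) / 2) ^ 2 ≤ Real.exp (-(1 - h)) := by
      have h1 : 1 - (1 - h) / 2 ≤ Real.exp (-((1 - h) / 2)) := by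
        linarith [Real.add_one_le_exp (-((1 - h) / 2))]
      have h2 : Real.exp (-(1 - h)) = Real.exp (-((1 - h) / 2)) ^ 2 := by
        rw [← Real.exp_nat_mul]; congr 1; push_cast; ring
      rw [h2]
      exact pow_le_pow_left₀ (by linarith) h1 2
    have hk : 1 / 16 ≤ Real.exp (-(1 - h)) - h := by nlinarith
    have ht := exp_tangent_at_seventeen y
    have hE : Real.exp (-y) * (1 / 16) ≤ Real.exp (-y) * (Real.exp (-(1 - h)) - h) :=
      mul_le_mul_of_nonneg_left hk (Real.exp_pos _).le
    rw [hi, hs, hp, hp2]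
    nlinarith

/-- The right side sums to zero over `j`: excesses cancel, and the slopes are compared with their
mean. -/
lemma deficit_twinningStep_sub_le (hn : 2 ≤ n) (t : ℕ) (x : Fin n → ℕ) (j : Fin n) :
    deficit (t + 1) (twinningStep x j) - deficit t x
      ≤ 2 * weight * excess x j + profileSlope (excess x j)
        - (∑ i, profileSlope (excess x i)) / n := by
  have : NeZero n := ⟨by omega⟩
  have h1 := local_drift hn x j
  have h2 := le_profileSum_twinningStep x j
  have h3 := mul_le_mul_of_nonneg_left (sq_increment_mul_mem hn x j).2 weight_pos.le
  unfold deficit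
  rw [quadratic_twinningStep, totalBalls_twinningStep]
  push_cast
  nlinarith

lemma sum_deficit_twinningStep_le (hn : 2 ≤ n) (t : ℕ) (x : Fin n → ℕ) :
    ∑ j, (deficit (t + 1) (twinningStep x j) - deficit t x) ≤ 0 := by
  have : NeZero n := ⟨by omega⟩
  have hn : (n : ℝ) ≠ 0 := Nat.cast_ne_zero.2 (NeZero.ne n)
  refine (sum_le_sum fun j _ => deficit_twinningStep_sub_le (by omega) t x j).trans_eq ?_
  simp only [sum_add_distrib, sum_sub_distrib, ← mul_sum, sum_excess, sum_const, card_univ,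
    Fintype.card_fin, nsmul_eq_mul, mul_div_cancel₀ _ hn]
  ring

lemma abs_deficit_twinningStep_sub_le (hn : 2 ≤ n) (t : ℕ) (x : Fin n → ℕ) (j : Fin n) :
    |deficit (t + 1) (twinningStep x j) - deficit t x| ≤ 8 + 2 * weight * |excess x j| := by
  have : NeZero n := ⟨by omega⟩
  have hw0 := weight_pos
  have hw1 := weight_le
  have h1 := abs_le.1 (abs_profileSum_twinningStep_sub_le x j)
  obtain ⟨h2, h3⟩ := sq_increment_mul_mem hn x j
  have h4 := increment_pos x j
  have h5 := increment_le x j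
  have h6 : |weight * (increment x j * excess x j)| ≤ 2 * weight * |excess x j| := by
    rw [abs_mul, abs_mul, abs_of_pos hw0, abs_of_pos (by linarith : 0 < increment x j)]
    nlinarith [mul_nonneg hw0.le (abs_nonneg (excess x j))]
  have h6 := abs_le.1 h6
  have h7 : 0 ≤ weight / 2 * (increment x j ^ 2 * (1 - 1 / n)) := by positivity
  have h8 : weight / 2 * (increment x j ^ 2 * (1 - 1 / n)) ≤ weight / 2 * 4 := by gcongr
  have h9 : deficit (t + 1) (twinningStep x j) - deficit t x
      = -(profileSum (twinningStep x j) - profileSum x) + weight * (increment x j * excess x j)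
        + weight / 2 * (increment x j ^ 2 * (1 - 1 / n)) - 3 * (increment x j - 1)
        + 16 * weight := by
    unfold deficit
    rw [quadratic_twinningStep, totalBalls_twinningStep]
    push_cast
    ring
  rw [h9, abs_le]
  constructor <;> linarith

lemma sum_sq_posPart_deficit_twinningStep_le (hn : 2 ≤ n) (t : ℕ) (x : Fin n → ℕ) :
    ∑ j, max (deficit (t + 1) (twinningStep x j)) 0 ^ 2
      ≤ n * (max (deficit t x) 0 ^ 2 + 128 + 8 * weight ^ 2 / n * quadratic x) := by
  have hn0 : (n : ℝ) ≠ 0 := Nat.cast_ne_zero.2 (by omega)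
  set r := deficit t x
  have h (j : Fin n) : max (deficit (t + 1) (twinningStep x j)) 0 ^ 2
      ≤ max r 0 ^ 2 + 2 * max r 0 * (deficit (t + 1) (twinningStep x j) - r)
        + (128 + 8 * weight ^ 2 * excess x j ^ 2) := by
    have h1 := abs_deficit_twinningStep_sub_le hn t x j
    set d := deficit (t + 1) (twinningStep x j) - r with hd
    have h2 : deficit (t + 1) (twinningStep x j) = r + d := by rw [hd]; ring
    have h3 : d ^ 2 ≤ 128 + 8 * weight ^ 2 * excess x j ^ 2 := by
      have h4 : d ^ 2 ≤ (8 + 2 * weight * |excess x j|) ^ 2 := by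
        rw [← sq_abs d]; exact pow_le_pow_left₀ (abs_nonneg _) h1 2
      rw [← sq_abs (excess x j)]
      nlinarith [sq_nonneg (8 - 2 * weight * |excess x j|)]
    -- The cross term `2 * max r 0 * d` has a nonnegative coefficient independent of `j`, so the
    -- supermartingale property discards it after summation.
    have h5 : max (r + d) 0 ^ 2 ≤ (max r 0 + d) ^ 2 := by
      rcases le_total (r + d) 0 with h6 | h6
      · rw [max_eq_right h6]; simpa using sq_nonneg _
      · rw [max_eq_left h6]
        exact pow_le_pow_left₀ h6 (by linarith [le_max_left r 0]) 2
    rw [h2]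
    nlinarith
  refine (sum_le_sum fun j _ => h j).trans ?_
  have h1 := mul_nonpos_of_nonneg_of_nonpos (mul_nonneg zero_le_two (le_max_right r 0))
    (sum_deficit_twinningStep_le hn t x)
  simp only [sum_add_distrib, ← mul_sum, sum_const, card_univ, Fintype.card_fin, nsmul_eq_mul]
  rw [show ∑ j, excess x j ^ 2 = quadratic x from rfl]
  have h2 : (n : ℝ) * (8 * weight ^ 2 / n * quadratic x) = 8 * weight ^ 2 * quadratic x := by
    field_simp
  rw [mul_add, h2]
  linarith

lemma le_deficit (t : ℕ) (x : Fin n → ℕ) :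
    16 * weight * t - 3 * ((totalBalls x : ℝ) - t) - n / (2 * weight) ≤ deficit t x := by
  have hw := weight_pos
  have h (i : Fin n) : profile (excess x i) ≤ weight / 2 * excess x i ^ 2
      + (1 + 1 / (2 * weight)) := by
    -- AM-GM absorbs the linear growth of `profile` into the quadratic potential.
    have h1 : 0 ≤ weight / 2 * (|excess x i| - 1 / weight) ^ 2 := by positivity
    have h2 : weight / 2 * (|excess x i| - 1 / weight) ^ 2
        = weight / 2 * excess x i ^ 2 - |excess x i| + 1 / (2 * weight) := by
      rw [← sq_abs (excess x i)]; field_simp; ring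
    linarith [profile_le (excess x i)]
  have hs := sum_le_sum fun i (_ : i ∈ univ) => h i
  simp only [sum_add_distrib, ← mul_sum, sum_const, card_univ, Fintype.card_fin,
    nsmul_eq_mul] at hs
  have h3 : (n : ℝ) * (1 / (2 * weight)) = n / (2 * weight) := by ring
  unfold deficit profileSum quadratic
  linarith

lemma deficit_zero : deficit 0 (fun _ : Fin n => 0) = 0 := by
  simp [deficit, profileSum, quadratic, excess, totalBalls, profile_zero]

lemma quadratic_zero : quadratic (fun _ : Fin n => 0) = 0 := by
  simp [quadratic, excess, totalBalls]

end Deterministic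

/-! ### Averaging over an independent uniform sample. -/

section Expectation

variable {n : ℕ} {Ω : Type*} [MeasurableSpace Ω] {μ : Measure Ω} {U : ℕ → Ω → Fin n}

lemma twinningLoad_congr {b c : ℕ → Fin n} {t : ℕ} (h : ∀ s < t, b s = c s) :
    twinningLoad b t = twinningLoad c t := by
  induction t with
  | zero => rfl
  | succ t ih =>
    rw [twinningLoad, twinningLoad, ih fun s hs => h s (hs.trans t.lt_succ_self),
      h t t.lt_succ_self]

lemma twinningSamples_eq (t : ℕ) : twinningSamples t = t := by
  induction t with
  | zero => rfl
  | succ t ih => rw [twinningSamples, ih]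

/-- The load vector as a function of the bins sampled so far. -/
lemma exists_twinningLoad_eq [NeZero n] (t : ℕ) :
    ∃ g : (range t → Fin n) → Fin n → ℕ, ∀ b : ℕ → Fin n,
      twinningLoad b t = g fun s => b s := by
  refine ⟨fun c => twinningLoad (fun s => if h : s ∈ range t then c ⟨s, h⟩ else 0) t,
    fun b => twinningLoad_congr fun s hs => ?_⟩
  simp [hs]

lemma integrable_twinningLoad [IsProbabilityMeasure μ] [NeZero n] (hU : IsUniformBinSampling μ U)
    (t : ℕ) (F : (Fin n → ℕ) → ℝ) :
    Integrable (fun ω => F (twinningLoad (fun s => U s ω) t)) μ := by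
  obtain ⟨g, hg⟩ := exists_twinningLoad_eq (n := n) t
  simp only [hg]
  have hm : Measurable fun ω => fun s : range t => U s ω :=
    measurable_pi_lambda _ fun s => hU.measurable s
  exact (Integrable.of_finite (μ := μ.map fun ω => fun s : range t => U s ω)
    (f := fun c => F (g c))).comp_measurable hm

lemma integral_twinningLoad_succ [IsProbabilityMeasure μ] [NeZero n]
    (hU : IsUniformBinSampling μ U) (t : ℕ) (F : (Fin n → ℕ) → ℝ) :
    ∫ ω, F (twinningLoad (fun s => U s ω) (t + 1)) ∂μ
      = ∫ ω, (∑ i, F (twinningStep (twinningLoad (fun s => U s ω) t) i)) / n ∂μ := by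
  obtain ⟨g, hg⟩ := exists_twinningLoad_eq (n := n) t
  have hmp : Measurable fun ω => fun s : range t => U s ω :=
    measurable_pi_lambda _ fun s => hU.measurable s
  have hind : IndepFun (fun ω => fun s : range t => U s ω) (U t) μ := by
    have h := hU.indep.indepFun_finset (range t) {t} (by simp) hU.measurable
    exact h.comp (φ := id) (ψ := fun c : (({t} : Finset ℕ) → Fin n) => c ⟨t, by simp⟩)
      measurable_id (measurable_pi_apply _)
  have hsplit (ω : Ω) : F (twinningLoad (fun s => U s ω) (t + 1))
      = ∑ i, (if U t ω = i then (1 : ℝ) else 0)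
          * F (twinningStep (twinningLoad (fun s => U s ω) t) i) := by
    simp [twinningLoad]
  have hint (i : Fin n) : Integrable (fun ω => (if U t ω = i then (1 : ℝ) else 0)
      * F (twinningStep (twinningLoad (fun s => U s ω) t) i)) μ := by
    refine (integrable_twinningLoad hU t fun x => F (twinningStep x i)).bdd_mul (c := 1) ?_ ?_
    · exact ((measurable_of_finite fun k : Fin n => if k = i then (1 : ℝ) else 0).comp
        (hU.measurable t)).aestronglyMeasurable
    · filter_upwards with ω
      split_ifs <;> simp
  simp only [hsplit]
  rw [integral_finsetSum _ fun i _ => hint i]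
  simp only [sum_div]
  rw [integral_finsetSum _ fun i _ =>
    (integrable_twinningLoad hU t fun x => F (twinningStep x i)).div_const _]
  refine sum_congr rfl fun i _ => ?_
  have hm1 : Measurable fun k : Fin n => if k = i then (1 : ℝ) else 0 := measurable_of_finite _
  have hm2 : Measurable fun c : range t → Fin n => F (twinningStep (g c) i) :=
    measurable_of_finite _
  have hprod := (hind.symm.comp hm1 hm2).integral_mul_eq_mul_integral
    (hm1.comp (hU.measurable t)).aestronglyMeasurable (hm2.comp hmp).aestronglyMeasurable
  have hone : ∫ ω, (if U t ω = i then (1 : ℝ) else 0) ∂μ = 1 / n := by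
    have hset : MeasurableSet {ω | U t ω = i} := hU.measurable t (measurableSet_singleton i)
    rw [← hU.uniform t i, ← integral_indicator_one hset]
    refine integral_congr_ae (.of_forall fun ω => ?_)
    simp [Set.indicator_apply]
  simp only [hg]
  rw [integral_div]
  refine hprod.trans ?_
  change (∫ ω, (if U t ω = i then (1 : ℝ) else 0) ∂μ) * _ = _
  rw [hone, one_div_mul_eq_div]
  rfl

/-- One-step comparison of expectations along Twinning. -/
lemma integral_twinningLoad_succ_le [IsProbabilityMeasure μ] [NeZero n]
    (hU : IsUniformBinSampling μ U) (t : ℕ) {F G : (Fin n → ℕ) → ℝ}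
    (h : ∀ x, ∑ i, F (twinningStep x i) ≤ n * G x) :
    ∫ ω, F (twinningLoad (fun s => U s ω) (t + 1)) ∂μ
      ≤ ∫ ω, G (twinningLoad (fun s => U s ω) t) ∂μ := by
  rw [integral_twinningLoad_succ hU]
  refine integral_mono
    (integrable_twinningLoad hU t fun x => (∑ i, F (twinningStep x i)) / n)
    (integrable_twinningLoad hU t G) fun ω => ?_
  have hn : (0 : ℝ) < n := Nat.cast_pos.2 (NeZero.pos n)
  exact (div_le_iff₀' hn).2 (h _)

lemma integral_quadratic_le [IsProbabilityMeasure μ] (hn : 2 ≤ n)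
    (hU : IsUniformBinSampling μ U) (t : ℕ) :
    ∫ ω, quadratic (twinningLoad (fun s => U s ω) t) ∂μ ≤ 4 * t := by
  have : NeZero n := ⟨by omega⟩
  induction t with
  | zero => simp [twinningLoad, quadratic_zero]
  | succ t ih =>
    have h := integral_twinningLoad_succ_le hU t (sum_quadratic_twinningStep_le hn)
    rw [integral_add (integrable_twinningLoad hU t quadratic) (integrable_const _)] at h
    simp only [integral_const, probReal_univ, one_smul] at h
    push_cast
    linarith

lemma integral_deficit_nonpos [IsProbabilityMeasure μ] (hn : 2 ≤ n)
    (hU : IsUniformBinSampling μ U) (t : ℕ) :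
    ∫ ω, deficit t (twinningLoad (fun s => U s ω) t) ∂μ ≤ 0 := by
  have : NeZero n := ⟨by omega⟩
  induction t with
  | zero => simp [twinningLoad, deficit_zero]
  | succ t ih =>
    refine (integral_twinningLoad_succ_le hU t (F := deficit (t + 1)) (G := deficit t)
      fun x => ?_).trans ih
    have h := sum_deficit_twinningStep_le hn t x
    simp only [sum_sub_distrib, sum_const, card_univ, Fintype.card_fin, nsmul_eq_mul] at h
    linarith

lemma integral_sq_posPart_deficit_le [IsProbabilityMeasure μ] (hn : 2 ≤ n)
    (hU : IsUniformBinSampling μ U) (t : ℕ) :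
    ∫ ω, max (deficit t (twinningLoad (fun s => U s ω) t)) 0 ^ 2 ∂μ
      ≤ 128 * t + 16 * weight ^ 2 / n * t ^ 2 := by
  have : NeZero n := ⟨by omega⟩
  induction t with
  | zero => simp [twinningLoad, deficit_zero]
  | succ t ih =>
    have h := integral_twinningLoad_succ_le hU t (F := fun x => max (deficit (t + 1) x) 0 ^ 2)
      (sum_sq_posPart_deficit_twinningStep_le hn t)
    have i1 := integrable_twinningLoad hU t fun x => max (deficit t x) 0 ^ 2
    have i2 := (integrable_twinningLoad hU t quadratic).const_mul (8 * weight ^ 2 / n)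
    rw [integral_add (f := fun ω => max (deficit t (twinningLoad (fun s => U s ω) t)) 0 ^ 2 + 128)
      (i1.add (integrable_const _)) i2, integral_add i1 (integrable_const _),
      integral_const_mul] at h
    simp only [integral_const, probReal_univ, one_smul] at h
    have hc : 0 ≤ 8 * weight ^ 2 / n := by positivity
    have hq := mul_le_mul_of_nonneg_left (integral_quadratic_le hn hU t) hc
    have he : 16 * weight ^ 2 / n * ((t : ℝ) + 1) ^ 2
        = 16 * weight ^ 2 / n * t ^ 2 + 8 * weight ^ 2 / n * (4 * t) + 16 * weight ^ 2 / n := by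
      ring
    have hc2 : 0 ≤ 16 * weight ^ 2 / n := by positivity
    push_cast
    rw [he]
    linarith

end Expectation

/-! ### Efficiency in mean and in probability. -/

section Efficiency

variable {n : ℕ} {Ω : Type*} [MeasurableSpace Ω] {μ : Measure Ω} {U : ℕ → Ω → Fin n}

lemma twinningEfficiency_eq (b : ℕ → Fin n) (m : ℕ) :
    twinningEfficiency b m = (totalBalls (twinningLoad b m) : ℝ) / m := by
  rw [twinningEfficiency, twinningSamples_eq]

/-- The average number of balls per sample is bounded below in expectation. -/
lemma le_integral_twinningEfficiency [IsProbabilityMeasure μ] (hn : 2 ≤ n)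
    (hU : IsUniformBinSampling μ U) {m : ℕ} (hm : 8 * n / weight ^ 2 ≤ (m : ℝ)) :
    1 + weight ≤ ∫ ω, twinningEfficiency (fun t => U t ω) m ∂μ := by
  have : NeZero n := ⟨by omega⟩
  have hw := weight_pos
  have hn0 : (0 : ℝ) < n := Nat.cast_pos.2 (by omega)
  have hm0 : (0 : ℝ) < m := lt_of_lt_of_le (by positivity) hm
  have hnm : (n : ℝ) / (2 * weight) ≤ weight * m := by
    rw [div_le_iff₀ (by positivity)] at hm ⊢
    nlinarith
  simp only [twinningEfficiency_eq]
  rw [integral_div, le_div_iff₀ hm0]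
  have iW := integrable_twinningLoad hU m fun x => (totalBalls x : ℝ)
  have h := (integral_mono
    (f := fun ω => (16 * weight * m + 3 * m - n / (2 * weight))
      - 3 * (totalBalls (twinningLoad (fun s => U s ω) m) : ℝ))
    ((integrable_const _).sub (iW.const_mul 3)) (integrable_twinningLoad hU m (deficit m))
    fun ω => by
      have h := le_deficit m (twinningLoad (fun s => U s ω) m)
      dsimp only
      linarith).trans (integral_deficit_nonpos hn hU m)
  rw [integral_sub (integrable_const _) (iW.const_mul 3), integral_const_mul] at h
  simp only [integral_const, probReal_univ, one_smul] at h
  nlinarith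

/-- The sample efficiency is bounded away from `1` with high probability. -/
lemma prob_twinningEfficiency_lt_le [IsProbabilityMeasure μ] (hn : 2 ≤ n)
    (hU : IsUniformBinSampling μ U) {m : ℕ} (hm : 8 * n / weight ^ 2 ≤ (m : ℝ)) :
    μ.real {ω | twinningEfficiency (fun t => U t ω) m < 1 + weight} ≤ 1 / (2 * n) := by
  have : NeZero n := ⟨by omega⟩
  have hw := weight_pos
  have hn0 : (0 : ℝ) < n := Nat.cast_pos.2 (by omega)
  have hm0 : (0 : ℝ) < m := lt_of_lt_of_le (by positivity) hm
  have hm' : 8 * (n : ℝ) ≤ m * weight ^ 2 := (div_le_iff₀ (by positivity)).1 hm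
  have hnm : (n : ℝ) / (2 * weight) ≤ weight * m := by
    rw [div_le_iff₀ (by positivity)]
    nlinarith
  have hsub : {ω | twinningEfficiency (fun t => U t ω) m < 1 + weight}
      ⊆ {ω | (8 * weight * m) ^ 2
          ≤ max (deficit m (twinningLoad (fun s => U s ω) m)) 0 ^ 2} := by
    intro ω hω
    replace hω : twinningEfficiency (fun t => U t ω) m < 1 + weight := hω
    rw [twinningEfficiency_eq, div_lt_iff₀ hm0] at hω
    have h := le_deficit m (twinningLoad (fun s => U s ω) m)
    have hpos : 0 < weight * m := by positivity
    -- `le_deficit` leaves 16 - 3 - 1 = 12 multiples of `weight * m`; 8 suffice.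
    have hd : 8 * weight * m ≤ deficit m (twinningLoad (fun s => U s ω) m) := by linarith
    exact pow_le_pow_left₀ (by positivity : 0 ≤ 8 * weight * (m : ℝ)) (le_max_of_le_left hd) 2
  have hmarkov := mul_meas_ge_le_integral_of_nonneg
    (.of_forall fun ω => sq_nonneg (max (deficit m (twinningLoad (fun s => U s ω) m)) 0))
    (integrable_twinningLoad hU m fun x => max (deficit m x) 0 ^ 2) ((8 * weight * m) ^ 2)
  have hp : μ.real {ω | twinningEfficiency (fun t => U t ω) m < 1 + weight}
      ≤ μ.real {ω | (8 * weight * m) ^ 2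
          ≤ max (deficit m (twinningLoad (fun s => U s ω) m)) 0 ^ 2} := measureReal_mono hsub
  have hbound := hmarkov.trans (integral_sq_posPart_deficit_le hn hU m)
  refine hp.trans (le_of_mul_le_mul_left (hbound.trans ?_) (by positivity :
    0 < (8 * weight * (m : ℝ)) ^ 2))
  have h1 : 128 * (m : ℝ) ≤ 16 * weight ^ 2 / n * m ^ 2 := by
    rw [div_mul_eq_mul_div, le_div_iff₀ hn0]
    nlinarith
  have h2 : (8 * weight * (m : ℝ)) ^ 2 * (1 / (2 * n)) = 2 * (16 * weight ^ 2 / n * m ^ 2) := by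
    field_simp; ring
  linarith

end Efficiency

end Twinning

theorem lemma3p3 :
    ∃ ρ : ℝ, 0 < ρ ∧ ∀ n : ℕ, 2 ≤ n → ∀ m : ℕ, ρ⁻¹ * ((n : ℝ) * Real.log (n : ℝ)) ≤ (m : ℝ) →
      ∀ (Ω : Type*) [MeasurableSpace Ω] (μ : Measure Ω) [IsProbabilityMeasure μ]
        (U : ℕ → Ω → Fin n), IsUniformBinSampling μ U →
        1 + ρ ≤ ∫ ω, twinningEfficiency (fun t => U t ω) m ∂μ ∧
        1 - (n : ℝ) ^ (-(1 / 4) : ℝ) ≤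
          μ.real {ω | 1 + ρ ≤ twinningEfficiency (fun t => U t ω) m} := by
  have hw := Twinning.weight_pos
  have hw1 := Twinning.weight_le
  -- Since `log n ≥ 1 / 2`, this makes the assumed bound on `m` at least `8 * n / weight ^ 2`.
  refine ⟨Twinning.weight ^ 2 / 16, by positivity, ?_⟩
  intro n hn m hm Ω _ μ _ U hU
  have hn2 : (2 : ℝ) ≤ n := by exact_mod_cast hn
  have hρ : Twinning.weight ^ 2 / 16 ≤ Twinning.weight := by nlinarith
  have hm' : 8 * n / Twinning.weight ^ 2 ≤ (m : ℝ) := by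
    refine le_trans ?_ hm
    have hlog : 1 / 2 ≤ Real.log n := by
      linarith [Real.log_two_gt_d9, Real.log_le_log (by norm_num) hn2]
    rw [inv_div, div_mul_eq_mul_div]
    exact div_le_div_of_nonneg_right (by nlinarith) (by positivity)
  refine ⟨(Twinning.le_integral_twinningEfficiency hn hU hm').trans' (by linarith), ?_⟩
  have hsub : {ω | twinningEfficiency (fun t => U t ω) m < 1 + Twinning.weight}ᶜ
      ⊆ {ω | 1 + Twinning.weight ^ 2 / 16 ≤ twinningEfficiency (fun t => U t ω) m} := by
    intro ω hω
    have h : 1 + Twinning.weight ≤ twinningEfficiency (fun t => U t ω) m :=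
      not_lt.1 fun h => hω h
    exact le_trans (by linarith) h
  have hcompl : 1 ≤ μ.real {ω | twinningEfficiency (fun t => U t ω) m < 1 + Twinning.weight}
      + μ.real {ω | twinningEfficiency (fun t => U t ω) m < 1 + Twinning.weight}ᶜ := by
    refine le_trans (le_of_eq ?_) (measureReal_union_le _ _)
    rw [Set.union_compl_self, probReal_univ]
  have hmono := measureReal_mono (μ := μ) hsub
  have hbad := Twinning.prob_twinningEfficiency_lt_le hn hU hm'
  have hpow : 1 / (2 * (n : ℝ)) ≤ (n : ℝ) ^ (-(1 / 4) : ℝ) := by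
    have h1 : (n : ℝ) ^ (-1 : ℝ) ≤ (n : ℝ) ^ (-(1 / 4) : ℝ) :=
      Real.rpow_le_rpow_of_exponent_le (by linarith) (by norm_num)
    rw [Real.rpow_neg_one, ← one_div] at h1
    refine le_trans (one_div_le_one_div_of_le (by linarith) (by linarith)) h1
  linarith
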